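/- Alphabets are finite. A (multi-valued partial) function is a map $f$ from $\Sigma^*$ to the subsets of $\Gamma^*$, for alphabets $\Sigma,\Gamma$; it is single-valued if $|f(x)|\le 1$ for every $x$. An npda is a one-way one-head nondeterministic pushdown automaton (finite sets of inner states, stack symbols and transitions) that reads $x\in\Sigma^*$ between two endmarkers, may make $\lambda$-moves, stops upon entering an accepting or a rejecting state, and has a write-only output tape on which each move writes at most one symbol. All npda's are required to satisfy the termination condition: on every input $x$, all computation paths reach an accepting or a rejecting state within $O(|x|)$ steps. It computes the function that maps $x$ to the set of all words produced on the output tape along accepting computation paths on $x$. An oracle npda has in addition a write-only query tape, on which each move writes at most one symbol, and three extra inner states $q_{query},q_{yes},q_{no}$: when it enters $q_{query}$, the word $s$ on the query tape is sent to the oracle $A$, the query tape becomes blank, and the next inner state is $q_{yes}$ if $s\in A$ and $q_{no}$ otherwise. For oracle npda's, the termination condition is required with an $O(|x|)$ bound that holds no matter what oracle is used. $\mathrm{CFL}$ is the family of context-free languages, and $\mathrm{CFLSV}$ is the class of all single-valued functions computed by npda's. For a language $A$, $\mathrm{CFL}_T^A$ is the family of languages recognized with oracle $A$ by oracle npda's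 without output tape ($x$ is accepted iff some computation path on $x$ reaches an accepting state), and $\mathrm{CFLSV}_T^A$ is the class of all single-valued functions computed with oracle $A$ by oracle npda's. For a family $\mathcal C$ of languages, $\mathrm{CFL}_T(\mathcal C)=\bigcup_{A\in\mathcal C}\mathrm{CFL}_T^A$ and $\mathrm{CFLSV}_T(\mathcal C)=\bigcup_{A\in\mathcal C}\mathrm{CFLSV}_T^A$. Define, for $k\ge 1$, $$\Sigma^{\mathrm{CFL}}_1=\mathrm{CFL},\qquad \Pi^{\mathrm{CFL}}_k=\{\overline{L}\mid L\in\Sigma^{\mathrm{CFL}}_k\},\qquad \Sigma^{\mathrm{CFL}}_{k+1}=\mathrm{CFL}_T(\Pi^{\mathrm{CFL}}_k),$$ $$\Sigma^{\mathrm{CFL}}_1\mathrm{SV}=\mathrm{CFLSV},\qquad \Sigma^{\mathrm{CFL}}_{k+1}\mathrm{SV}=\mathrm{CFLSV}_T(\Pi^{\mathrm{CFL}}_k).$$ Let $e\ge 2$ and $k\ge 1$. If $\Sigma^{\mathrm{CFL}}_k\mathrm{SV}=\Sigma^{\mathrm{CFL}}_{k+1}\mathrm{SV}$, then $\Sigma^{\mathrm{CFL}}_k=\Sigma^{\mathrm{CFL}}_{k+1}$.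 If $\Sigma^{\mathrm{CFL}}_k=\Sigma^{\mathrm{CFL}}_{k+1}$, then $\Sigma^{\mathrm{CFL}}_{k+1}\mathrm{SV}=\Sigma^{\mathrm{CFL}}_{k+e}\mathrm{SV}$. -/

import Mathlib

namespace CFLHierarchy

/-! ### Families of languages and of multi-valued partial functions

Alphabets are finite types.  A multi-valued partial function is a map from words to sets of words;
it is undefined where the value is the empty set. -/

/-- A family of languages, over all finite alphabets `α`. -/
abbrev LanguageFamily : Type 1 :=
  (α : Type) → [Finite α] → Set (Language α)

/-- A family of multi-valued partial functions from words over `α` to words over `γ`,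
for all finite alphabets `α` and `γ`. -/
abbrev FunctionFamily : Type 1 :=
  (α γ : Type) → [Finite α] → [Finite γ] → Set (List α → Set (List γ))

/-- A multi-valued partial function is single-valued if it has at most one value everywhere. -/
def SingleValued {α γ : Type} (f : List α → Set (List γ)) : Prop :=
  ∀ x, (f x).Subsingleton

/-- The family `co-C` of the complements (with respect to all words over the same alphabet) of
the languages in `C`. -/
def co (C : LanguageFamily) : LanguageFamily :=
  fun α _ => {L | Lᶜ ∈ C α}

/-! ### Input tapes and the termination condition -/

/-- A symbol on the input tape: an input symbol or one of the two endmarkers. -/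
inductive TapeSymbol (α : Type) : Type
  | left : TapeSymbol α
  | letter (a : α) : TapeSymbol α
  | right : TapeSymbol α

/-- The input tape for the word `x`: left endmarker, `x`, right endmarker. -/
def inputTape {α : Type} (x : List α) : List (TapeSymbol α) :=
  TapeSymbol.left :: (x.map TapeSymbol.letter ++ [TapeSymbol.right])

/-- `TerminatesWithin step c halting t`: every computation path from `c` makes at most `t` steps,
and a path which cannot be continued has reached a halting configuration. -/
def TerminatesWithin {C : Type} (step : C → C → Prop) (c : C) (halting : C → Prop) (t : ℕ) : Prop :=
  (∀ (m : ℕ) (path : ℕ → C), path 0 = c → (∀ i < m, step (path i) (path (i + 1))) → m ≤ t) ∧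
  (∀ d, Relation.ReflTransGen step c d → (∀ d', ¬ step d d') → halting d)

/-! ### Nondeterministic pushdown automata with a write-only output tape -/

/-- A one-way one-head nondeterministic pushdown automaton with input alphabet `α` and a write-only
output tape over the alphabet `γ`.

`(p, w, v) ∈ trans q s z` means: in the inner state `q`, with `z` on top of the stack, the machine
may scan the tape symbol `s` and move its input head one cell to the right (if `s = none`, it makes
a move that does not touch the input tape), enter the state `p`, replace `z` by the word `w` (whose
first symbol becomes the topmost one), and write `v` on the output tape (nothing if `v = none`). -/
structure NPDA (α γ : Type) : Type 1 where
  State : Type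
  Stack : Type
  finite_state : Finite State
  finite_stack : Finite Stack
  start : State
  bottom : Stack
  acc : Set State
  rej : Set State
  acc_disjoint_rej : Disjoint acc rej
  trans : State → Option (TapeSymbol α) → Stack → Set (State × List Stack × Option γ)
  finite_trans : ∀ q s z, (trans q s z).Finite

namespace NPDA

variable {α γ : Type}

/-- A configuration: inner state, the part of the input tape not yet scanned, the stack (topmost
symbol first), and the content of the output tape. -/
structure Config (M : NPDA α γ) : Type where
  state : M.State
  input : List (TapeSymbol α)
  stack : List M.Stack
  output : List γ

/-- The halting states are the accepting and the rejecting ones. -/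
def halt (M : NPDA α γ) : Set M.State := M.acc ∪ M.rej

/-- One step of a computation.  No step is made from a halting state. -/
inductive Step (M : NPDA α γ) : M.Config → M.Config → Prop
  | scan {q p : M.State} {s : TapeSymbol α} {i : List (TapeSymbol α)} {z : M.Stack}
      {w st : List M.Stack} {v : Option γ} {o : List γ} :
      q ∉ M.halt → (p, w, v) ∈ M.trans q (some s) z →
      Step M ⟨q, s :: i, z :: st, o⟩ ⟨p, i, w ++ st, o ++ v.toList⟩
  | lambda {q p : M.State} {i : List (TapeSymbol α)} {z : M.Stack}
      {w st : List M.Stack} {v : Option γ} {o : List γ} :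
      q ∉ M.halt → (p, w, v) ∈ M.trans q none z →
      Step M ⟨q, i, z :: st, o⟩ ⟨p, i, w ++ st, o ++ v.toList⟩

/-- The initial configuration on the input `x`. -/
def init (M : NPDA α γ) (x : List α) : M.Config :=
  ⟨M.start, inputTape x, [M.bottom], []⟩

/-- The termination condition: all computation paths reach halting states in linearly many steps. -/
def Terminates (M : NPDA α γ) : Prop :=
  ∃ a b : ℕ, ∀ x : List α,
    TerminatesWithin M.Step (M.init x) (fun c => c.state ∈ M.halt) (a * x.length + b)

/-- The set of valid outcomes on the input `x`: the words produced along accepting paths. -/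
def outcomes (M : NPDA α γ) (x : List α) : Set (List γ) :=
  {y | ∃ c, Relation.ReflTransGen M.Step (M.init x) c ∧ c.state ∈ M.acc ∧ c.output = y}

end NPDA

/-! ### Oracle machines -/

/-- An oracle npda: a nondeterministic pushdown automaton with input alphabet `α`, a write-only query
tape over the alphabet `β`, a write-only output tape over the alphabet `γ`, and three extra inner
states `query`, `yes`, `no`.

`(p, w, u, v) ∈ trans q s z` is read as for an `NPDA`; in addition `u` is written on the query tape
(nothing if `u = none`). -/
structure OracleNPDA (α β γ : Type) : Type 1 where
  State : Type
  Stack : Type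
  finite_state : Finite State
  finite_stack : Finite Stack
  start : State
  bottom : Stack
  acc : Set State
  rej : Set State
  acc_disjoint_rej : Disjoint acc rej
  query : State
  yes : State
  no : State
  query_ne_yes : query ≠ yes
  query_ne_no : query ≠ no
  yes_ne_no : yes ≠ no
  query_not_halting : query ∉ acc ∪ rej
  yes_not_halting : yes ∉ acc ∪ rej
  no_not_halting : no ∉ acc ∪ rej
  trans : State → Option (TapeSymbol α) → Stack →
    Set (State × List Stack × Option β × Option γ)
  finite_trans : ∀ q s z, (trans q s z).Finite

namespace OracleNPDA

variable {α β γ : Type}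

/-- A configuration: inner state, the part of the input tape not yet scanned, the stack (topmost
symbol first), the content of the query tape, and the content of the output tape. -/
structure Config (M : OracleNPDA α β γ) : Type where
  state : M.State
  input : List (TapeSymbol α)
  stack : List M.Stack
  queryTape : List β
  output : List γ

/-- The halting states are the accepting and the rejecting ones. -/
def halt (M : OracleNPDA α β γ) : Set M.State := M.acc ∪ M.rej

/-- One step of a computation relative to the oracle `A`.  No step is made from a halting state.
In the query state the word on the query tape is sent to `A`, which sets the inner state to `yes` or
`no`; the query tape becomes blank again. -/
inductive Step (M : OracleNPDA α β γ) (A : Language β) : M.Config → M.Config → Prop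
  | scan {q p : M.State} {s : TapeSymbol α} {i : List (TapeSymbol α)} {z : M.Stack}
      {w st : List M.Stack} {u : Option β} {v : Option γ} {t : List β} {o : List γ} :
      q ∉ M.halt → q ≠ M.query → (p, w, u, v) ∈ M.trans q (some s) z →
      Step M A ⟨q, s :: i, z :: st, t, o⟩ ⟨p, i, w ++ st, t ++ u.toList, o ++ v.toList⟩
  | lambda {q p : M.State} {i : List (TapeSymbol α)} {z : M.Stack}
      {w st : List M.Stack} {u : Option β} {v : Option γ} {t : List β} {o : List γ} :
      q ∉ M.halt → q ≠ M.query → (p, w, u, v) ∈ M.trans q none z →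
      Step M A ⟨q, i, z :: st, t, o⟩ ⟨p, i, w ++ st, t ++ u.toList, o ++ v.toList⟩
  | answerYes {i : List (TapeSymbol α)} {st : List M.Stack} {t : List β} {o : List γ} :
      t ∈ A → Step M A ⟨M.query, i, st, t, o⟩ ⟨M.yes, i, st, [], o⟩
  | answerNo {i : List (TapeSymbol α)} {st : List M.Stack} {t : List β} {o : List γ} :
      t ∉ A → Step M A ⟨M.query, i, st, t, o⟩ ⟨M.no, i, st, [], o⟩

/-- The initial configuration on the input `x`. -/
def init (M : OracleNPDA α β γ) (x : List α) : M.Config :=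
  ⟨M.start, inputTape x, [M.bottom], [], []⟩

/-- The termination condition: all computation paths reach halting states in linearly many steps,
no matter what oracle is used. -/
def Terminates (M : OracleNPDA α β γ) : Prop :=
  ∃ a b : ℕ, ∀ (A : Language β) (x : List α),
    TerminatesWithin (M.Step A) (M.init x) (fun c => c.state ∈ M.halt) (a * x.length + b)

/-- The set of valid outcomes on the input `x` relative to the oracle `A`: the words produced
along accepting paths. -/
def outcomes (M : OracleNPDA α β γ) (A : Language β) (x : List α) : Set (List γ) :=
  {y | ∃ c, Relation.ReflTransGen (M.Step A) (M.init x) c ∧ c.state ∈ M.acc ∧ c.output = y}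

/-- The language recognized relative to the oracle `A`: the inputs with an accepting path. -/
def accepts (M : OracleNPDA α β γ) (A : Language β) : Language α :=
  {x | ∃ c, Relation.ReflTransGen (M.Step A) (M.init x) c ∧ c.state ∈ M.acc}

end OracleNPDA

/-! ### The classes -/

/-- The family of context-free languages. -/
def CFL : LanguageFamily :=
  fun α _ => {L : Language α | L.IsContextFree}

/-- The languages recognized with oracle `A` by oracle npda's satisfying the termination
condition.  A recognizer has no output tape: its output alphabet is empty. -/
def CFLTuring {β : Type} (A : Language β) : LanguageFamily :=
  fun α _ => {L | ∃ M : OracleNPDA α β Empty, M.Terminates ∧ M.accepts A = L}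

/-- The union of the families `CFLTuring A` over all languages `A` in `C`. -/
def CFLTuringFamily (C : LanguageFamily) : LanguageFamily :=
  fun α _ => {L | ∃ (β : Type) (_ : Finite β) (A : Language β), A ∈ C β ∧ L ∈ CFLTuring A α}

/-- The functions computed by npda's with an output tape that satisfy the termination condition. -/
def CFLMV : FunctionFamily :=
  fun α γ _ _ => {f | ∃ M : NPDA α γ, M.Terminates ∧ ∀ x, f x = M.outcomes x}

/-- The single-valued functions in `CFLMV`. -/
def CFLSV : FunctionFamily :=
  fun α γ _ _ => {f | f ∈ CFLMV α γ ∧ SingleValued f}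

/-- The functions computed with oracle `A` by oracle npda's that satisfy the termination
condition. -/
def CFLMVTuring {β : Type} (A : Language β) : FunctionFamily :=
  fun α γ _ _ => {f | ∃ M : OracleNPDA α β γ, M.Terminates ∧ ∀ x, f x = M.outcomes A x}

/-- The single-valued functions in `CFLMVTuring A`. -/
def CFLSVTuring {β : Type} (A : Language β) : FunctionFamily :=
  fun α γ _ _ => {f | f ∈ CFLMVTuring A α γ ∧ SingleValued f}

/-- The union of the families `CFLSVTuring A` over all languages `A` in `C`. -/
def CFLSVTuringFamily (C : LanguageFamily) : FunctionFamily :=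
  fun α γ _ _ => {f | ∃ (β : Type) (_ : Finite β) (A : Language β),
    A ∈ C β ∧ f ∈ CFLSVTuring A α γ}

/-- The `k`-th `Σ`-level of the CFL hierarchy, for `k ≥ 1`: level `1` is `CFL`, and level `k + 1`
is obtained by Turing relativization to the `k`-th `Π`-level, i.e. to the complements of the
languages in the `k`-th `Σ`-level.  (There is no level `0`; that value is a placeholder.) -/
def SigmaCFL : ℕ → LanguageFamily
  | 0 => fun _ _ => ∅
  | 1 => CFL
  | k + 2 => CFLTuringFamily (co (SigmaCFL (k + 1)))

/-- The `k`-th `Π`-level of the CFL hierarchy, for `k ≥ 1`. -/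
def PiCFL (k : ℕ) : LanguageFamily := co (SigmaCFL k)

/-- The `k`-th `Σ`-level of the hierarchy of single-valued functions over `CFLSV`, for `k ≥ 1`.
(There is no level `0`; that value is a placeholder.) -/
def SigmaCFLSV : ℕ → FunctionFamily
  | 0 => fun _ _ _ _ => ∅
  | 1 => CFLSV
  | k + 2 => CFLSVTuringFamily (PiCFL (k + 1))

end CFLHierarchy

/-! A language `L` is coded by `indicator L`, the function into words over the empty alphabet with
value `[]` exactly on `L`. It is automatically single-valued, and a recognizer, whose output
alphabet is empty, computes the indicator of the language it accepts. Hence on every level given by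
oracle machines, `L` lies in the Σ-level iff `indicator L` lies in the SV-level
(`indicator_mem_CFLSVTuringFamily_iff`), and for `k ≥ 2` the first implication follows.

For `k = 1` two facts about context-free languages, defined by grammars, are needed. The domain of a
function computed by an npda is context-free (`NPDA.isContextFree_domain`): the npda is simulated by
a pushdown system without endmarkers, which the triple construction turns into a grammar. And `CFL`
is contained in the second level (`subset_CFLTuringFamily_co`): a machine copies its input to the
query tape and negates the answer of the complement, so no grammar has to be turned into a
linear-time npda.

For the second implication, each Σ-level arises from the preceding one by one fixed operator, so a
repeated level is a fixed point; the SV-level `k + 1` depends only on the Σ-level `k`. -/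

namespace CFLHierarchy

/-! ### Pushdown systems and context-free grammars -/

section Pops

variable {Q Γ α : Type} (δ : Q → Γ → Option α → Q → List Γ → Prop)

/-- `Pops δ q s x r`: the pushdown system with moves `δ` can go from the state `q` with the stack
`s` to the state `r` with the empty stack while reading exactly the word `x`. -/
inductive Pops : Q → List Γ → List α → Q → Prop
  | nil (q : Q) : Pops q [] [] q
  | step {q p r : Q} {z : Γ} {a : Option α} {w s : List Γ} {x : List α} :
      δ q z a p w → Pops p (w ++ s) x r → Pops q (z :: s) (a.toList ++ x) r

variable {δ}

theorem Pops.append {q p r : Q} {s t : List Γ} {x y : List α} (h : Pops δ q s x p)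
    (h' : Pops δ p t y r) : Pops δ q (s ++ t) (x ++ y) r := by
  induction h with
  | nil => exact h'
  | step hδ _ ih =>
    rw [List.append_assoc]
    exact Pops.step hδ (by simpa using ih h')

variable (δ)

/-- The rules of the triple construction: the nonterminal `(q, w, r)` stands for the words read
while going from `q` to `r` and popping `w`. -/
inductive IsTripleRule (B : ℕ) : ContextFreeRule α (Q × List Γ × Q) → Prop
  | nil (q : Q) : IsTripleRule B ⟨(q, [], q), []⟩
  | cons (q t r : Q) (z : Γ) (w : List Γ) : w.length < B →
      IsTripleRule B ⟨(q, z :: w, r), [.nonterminal (q, [z], t), .nonterminal (t, w, r)]⟩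
  | move {q p : Q} {z : Γ} {a : Option α} {w : List Γ} (r : Q) : δ q z a p w →
      IsTripleRule B ⟨(q, [z], r), a.toList.map .terminal ++ [.nonterminal (p, w, r)]⟩

/-- The type of nonterminals is infinite, but a grammar only needs finitely many rules. These are
indexed by states, symbols and stack words of length at most `B`. -/
theorem finite_isTripleRule [Finite Q] [Finite Γ] [Finite α] {B : ℕ}
    (hB : ∀ q z a p w, δ q z a p w → w.length ≤ B) :
    {ρ | IsTripleRule δ B ρ}.Finite := by
  have hW : Finite {w : List Γ // w.length ≤ B} := (List.finite_length_le Γ B).to_subtype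
  have h1 := Set.finite_range
    (fun q : Q => (⟨(q, [], q), []⟩ : ContextFreeRule α (Q × List Γ × Q)))
  have h2 := Set.finite_range
    (fun i : Q × Q × Q × Γ × {w : List Γ // w.length ≤ B} =>
      (⟨(i.1, i.2.2.2.1 :: i.2.2.2.2.1, i.2.2.1),
        [.nonterminal (i.1, [i.2.2.2.1], i.2.1), .nonterminal (i.2.1, i.2.2.2.2.1, i.2.2.1)]⟩ :
        ContextFreeRule α (Q × List Γ × Q)))
  have h3 := Set.finite_range
    (fun i : Q × Q × Q × Γ × Option α × {w : List Γ // w.length ≤ B} =>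
      (⟨(i.1, [i.2.2.2.1], i.2.2.1),
        i.2.2.2.2.1.toList.map .terminal ++ [.nonterminal (i.2.1, i.2.2.2.2.2.1, i.2.2.1)]⟩ :
        ContextFreeRule α (Q × List Γ × Q)))
  refine ((h1.union h2).union h3).subset ?_
  rintro ρ (q | ⟨q, t, r, z, w, hw⟩ | ⟨r, hδ⟩)
  · exact .inl (.inl ⟨q, rfl⟩)
  · exact .inl (.inr ⟨(q, t, r, z, ⟨w, hw.le⟩), rfl⟩)
  · rename_i q p z a w
    exact .inr ⟨(q, p, r, z, a, ⟨w, hB _ _ _ _ _ hδ⟩), rfl⟩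

/-- The words described by a symbol of the triple construction. -/
def tripleSem : Symbol α (Q × List Γ × Q) → Language α
  | .terminal a => {[a]}
  | .nonterminal (q, w, r) => {x | Pops δ q w x r}

theorem prod_tripleSem_terminal (x : List α) :
    x ∈ ((x.map Symbol.terminal).map (tripleSem δ)).prod := by
  induction x with
  | nil => exact Language.nil_mem_one
  | cons a x ih =>
    rw [List.map_cons, List.map_cons, List.prod_cons]
    exact Language.mem_mul.2 ⟨[a], rfl, x, ih, rfl⟩

/-- Soundness of a single rule: splitting a triple is concatenation of runs, and a move rule
prefixes one move to a run. -/
theorem prod_tripleSem_output_le {B : ℕ} {ρ : ContextFreeRule α (Q × List Γ × Q)}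
    (hρ : IsTripleRule δ B ρ) :
    (ρ.output.map (tripleSem δ)).prod ≤ tripleSem δ (.nonterminal ρ.input) := by
  intro x hx
  cases hρ with
  | nil q =>
    obtain rfl : x = [] := hx
    exact Pops.nil q
  | cons q t r z w _ =>
    simp only [List.map_cons, List.map_nil, List.prod_cons, List.prod_nil, mul_one] at hx
    obtain ⟨y, hy, y', hy', rfl⟩ := Language.mem_mul.1 hx
    exact Pops.append (s := [z]) hy hy'
  | @move q p z a w r hδ =>
    have key : ∃ y, Pops δ p w y r ∧ x = a.toList ++ y := by
      cases a with
      | none =>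
        simp only [Option.toList_none, List.map_nil, List.nil_append, List.map_cons,
          List.prod_cons, List.prod_nil, mul_one] at hx
        exact ⟨x, hx, rfl⟩
      | some a =>
        simp only [Option.toList_some, List.map_nil, List.cons_append, List.nil_append,
          List.map_cons, List.prod_cons, List.prod_nil, mul_one] at hx
        obtain ⟨y, hy, y', hy', rfl⟩ := Language.mem_mul.1 hx
        obtain rfl : y = [a] := hy
        exact ⟨y', hy', rfl⟩
    obtain ⟨y, hy, rfl⟩ := key
    exact Pops.step hδ (by simpa using hy)

/-- `g` derives from the triples along a stack, one for each stack symbol, a given word. -/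
def DerivesStack (g : Q → List Γ → Q → List α → Prop) : Q → List Γ → List α → Q → Prop
  | q, [], x, r => q = r ∧ x = []
  | q, z :: s, x, r => ∃ t y y', x = y ++ y' ∧ g q [z] t y ∧ DerivesStack g t s y' r

/-- Needed after a move that pushes `w` onto `s`: the part for `w` must be regrouped under the
symbol that `w` replaced. -/
theorem DerivesStack.split {g : Q → List Γ → Q → List α → Prop} {s t : List Γ} {q r : Q}
    {x : List α} (h : DerivesStack g q (s ++ t) x r) :
    ∃ p y y', x = y ++ y' ∧ DerivesStack g q s y p ∧ DerivesStack g p t y' r := by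
  induction s generalizing q x with
  | nil => exact ⟨q, [], x, rfl, ⟨rfl, rfl⟩, h⟩
  | cons z s ih =>
    obtain ⟨t', y, y', rfl, hg, h'⟩ := h
    obtain ⟨p, u, u', rfl, h1, h2⟩ := ih h'
    exact ⟨p, y ++ u, u', by simp, ⟨t', y, u, rfl, hg, h1⟩, h2⟩

/-- The words read by a finite pushdown system which starts with a given stack and stops in a given
state with the empty stack form a context-free language. -/
theorem isContextFree_pops [Finite Q] [Finite Γ] [Finite α] {B : ℕ}
    (hB : ∀ q z a p w, δ q z a p w → w.length ≤ B) (q₀ qf : Q) (s₀ : List Γ) :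
    Language.IsContextFree ({x | Pops δ q₀ s₀ x qf} : Language α) := by
  -- The start nonterminal carries `s₀`, and the splitting rules only expand words of length at most
  -- `B`.
  wlog hs : s₀.length ≤ B generalizing B
  · exact this (B := max B s₀.length) (fun q z a p w h => (hB q z a p w h).trans (le_max_left _ _))
      (le_max_right _ _)
  let g : ContextFreeGrammar α :=
    ⟨Q × List Γ × Q, (q₀, s₀, qf), (finite_isTripleRule δ hB).toFinset⟩
  have mem {ρ : ContextFreeRule α (Q × List Γ × Q)} (hρ : IsTripleRule δ B ρ) :
      g.Produces [.nonterminal ρ.input] ρ.output :=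
    ⟨ρ, (finite_isTripleRule δ hB).mem_toFinset.2 hρ, ContextFreeRule.Rewrites.input_output⟩
  let G : Q → List Γ → Q → List α → Prop := fun q w r x =>
    g.Derives [.nonterminal (q, w, r)] (x.map .terminal)
  have gen {q r : Q} {w : List Γ} {x : List α} (hw : w.length ≤ B)
      (h : DerivesStack G q w x r) : G q w r x := by
    induction w generalizing q x with
    | nil =>
      obtain ⟨rfl, rfl⟩ := h
      exact (mem (.nil q)).single
    | cons z w ih =>
      obtain ⟨t, y, y', rfl, h1, h2⟩ := h
      have hw' : w.length < B := hw
      have h3 := ih hw'.le h2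
      refine (mem (.cons q t r z w hw')).trans_derives ?_
      rw [List.map_append]
      exact (h1.append_right _).trans (h3.append_left _)
  have complete {q r : Q} {s : List Γ} {x : List α} (h : Pops δ q s x r) :
      DerivesStack G q s x r := by
    induction h with
    | nil q => exact ⟨rfl, rfl⟩
    | @step q p r z a w s x hδ _ ih =>
      obtain ⟨t, y, y', rfl, h1, h2⟩ := ih.split
      refine ⟨t, a.toList ++ y, y', by simp, ?_, h2⟩
      refine (mem (.move t hδ)).trans_derives ?_
      rw [List.map_append]
      exact (gen (hB _ _ _ _ _ hδ) h1).append_left _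
  -- Along a derivation the language denoted by the sentential form can only shrink.
  have sound {u v : List (Symbol α g.NT)} (h : g.Derives u v) :
      (v.map (tripleSem δ)).prod ≤ (u.map (tripleSem δ)).prod := by
    induction h with
    | refl => exact le_rfl
    | tail _ h ih =>
      refine le_trans ?_ ih
      obtain ⟨ρ, hρ, hr⟩ := h
      obtain ⟨p, q, rfl, rfl⟩ := hr.exists_parts
      have := prod_tripleSem_output_le δ ((finite_isTripleRule δ hB).mem_toFinset.1 hρ)
      simp only [List.map_append, List.prod_append, List.map_cons, List.map_nil, List.prod_cons,
        List.prod_nil, mul_one]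
      gcongr
  refine ⟨g, Set.ext fun x => ⟨fun h => ?_, fun h => gen hs (complete h)⟩⟩
  have := sound h (prod_tripleSem_terminal δ x)
  rw [List.map_singleton, List.prod_singleton] at this
  exact this

end Pops

/-! ### The domain of a function computed by an npda is context-free -/

/-- The position of the input head: before the left endmarker, between the endmarkers, or after the
right endmarker. -/
inductive HeadPhase : Type
  | start
  | middle
  | finish

instance : Finite HeadPhase :=
  Finite.of_injective (fun p : HeadPhase => match p with
    | .start => (0 : Fin 3)
    | .middle => 1
    | .finish => 2) (by rintro (_ | _ | _) (_ | _ | _) h <;> simp_all)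

/-- `IsRemaining ph x i`: the remaining input tape is `i` if the head is in the phase `ph` and the
word `x` has not been scanned yet. -/
inductive IsRemaining {α : Type} : HeadPhase → List α → List (TapeSymbol α) → Prop
  | start (x : List α) : IsRemaining .start x (inputTape x)
  | middle (x : List α) : IsRemaining .middle x (x.map .letter ++ [.right])
  | finish : IsRemaining .finish [] []

namespace NPDA

variable {α γ : Type} (M : NPDA α γ)

/-- The moves of a pushdown system without endmarkers which simulates `M`.  The stack of `M` lies
on an additional bottom symbol `none`; once `M` accepts, the rest of the input is skipped, and the
state `none` is entered, in which the stack is discarded. -/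
inductive Sim : Option (M.State × HeadPhase) → Option M.Stack → Option α →
    Option (M.State × HeadPhase) → List (Option M.Stack) → Prop
  | left {q p : M.State} {z : M.Stack} {w : List M.Stack} {v : Option γ} :
      q ∉ M.halt → (p, w, v) ∈ M.trans q (some .left) z →
      Sim (some (q, .start)) (some z) none (some (p, .middle)) (w.map some)
  | letter {q p : M.State} {z : M.Stack} {w : List M.Stack} {v : Option γ} {a : α} :
      q ∉ M.halt → (p, w, v) ∈ M.trans q (some (.letter a)) z →
      Sim (some (q, .middle)) (some z) (some a) (some (p, .middle)) (w.map some)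
  -- The end of the input is guessed here; a run with a wrong guess cannot read the remaining
  -- letters.
  | right {q p : M.State} {z : M.Stack} {w : List M.Stack} {v : Option γ} :
      q ∉ M.halt → (p, w, v) ∈ M.trans q (some .right) z →
      Sim (some (q, .middle)) (some z) none (some (p, .finish)) (w.map some)
  | lambda {q p : M.State} {z : M.Stack} {w : List M.Stack} {v : Option γ} {ph : HeadPhase} :
      q ∉ M.halt → (p, w, v) ∈ M.trans q none z →
      Sim (some (q, ph)) (some z) none (some (p, ph)) (w.map some)
  | read {q : M.State} {ph : HeadPhase} (a : α) (z : Option M.Stack) :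
      q ∈ M.acc → ph ≠ .finish → Sim (some (q, ph)) z (some a) (some (q, ph)) [z]
  | enter {q : M.State} (ph : HeadPhase) (z : Option M.Stack) :
      q ∈ M.acc → Sim (some (q, ph)) z none none []
  | pop (z : Option M.Stack) : Sim none z none none []

theorem exists_push_bound [Finite α] :
    ∃ B, ∀ q z a p w, M.Sim q z a p w → w.length ≤ B := by
  have := M.finite_state
  have := M.finite_stack
  have : Finite (TapeSymbol α) :=
    Finite.of_injective (β := Option (Option α)) (fun s => match s with
      | .left => none
      | .right => some none
      | .letter a => some (some a)) (by rintro (_ | _ | _) (_ | _ | _) h <;> simp_all)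
  have hfin : (⋃ q, ⋃ s, ⋃ z, M.trans q s z).Finite :=
    Set.finite_iUnion fun q => Set.finite_iUnion fun s => Set.finite_iUnion fun z =>
      M.finite_trans q s z
  obtain ⟨B, hB⟩ := (hfin.image fun t => t.2.1.length).bddAbove
  have key {q s z p w v} (h : (p, w, v) ∈ M.trans q s z) : w.length ≤ B :=
    hB ⟨(p, w, v), by simp only [Set.mem_iUnion]; exact ⟨q, s, z, h⟩, rfl⟩
  -- The 1 accounts for `read`, which puts the top symbol back.
  refine ⟨max B 1, fun q z a p w h => ?_⟩
  cases h with
  | left _ h | letter _ h | right _ h | lambda _ h =>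
    exact (List.length_map _).trans_le ((key h).trans (le_max_left _ _))
  | enter | read | pop => simp

theorem pops_sim_none (s : List (Option M.Stack)) : Pops M.Sim none s [] none := by
  induction s with
  | nil => exact .nil _
  | cons z s ih => exact .step (Sim.pop z) ih

theorem pops_sim_acc {q : M.State} (hq : q ∈ M.acc) {ph : HeadPhase} {x : List α}
    {i : List (TapeSymbol α)} (hx : IsRemaining ph x i) (z : Option M.Stack)
    (s : List (Option M.Stack)) : Pops M.Sim (some (q, ph)) (z :: s) x none := by
  have skip (hph : ph ≠ .finish) (x : List α) :
      Pops M.Sim (some (q, ph)) (z :: s) x none := by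
    induction x with
    | nil => exact .step (Sim.enter ph z hq) (M.pops_sim_none s)
    | cons a x ih => exact .step (Sim.read a z hq hph) ih
  cases hx with
  | start | middle => exact skip (by simp) x
  | finish => exact .step (Sim.enter _ z hq) (M.pops_sim_none s)

theorem eq_nil_of_pops_sim {s : Option (M.State × HeadPhase)} {t : List (Option M.Stack)}
    {x : List α} {r : Option (M.State × HeadPhase)} (h : Pops M.Sim s t x r)
    (hs : ∀ q ph, s = some (q, ph) → ph = .finish) : x = [] := by
  induction h with
  | nil => rfl
  | step hδ _ ih =>
    cases hδ with
    | left | letter | right => cases hs _ _ rfl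
    | lambda => exact ih fun q ph h => by cases h; exact hs _ _ rfl
    | read a z hq hph => exact absurd (hs _ _ rfl) hph
    | enter | pop => exact ih fun q ph h => by cases h

theorem pops_sim_of_accepting {c d : M.Config} (h : Relation.ReflTransGen M.Step c d)
    (hd : d.state ∈ M.acc) {ph : HeadPhase} {x : List α} (hx : IsRemaining ph x c.input) :
    Pops M.Sim (some (c.state, ph)) (c.stack.map some ++ [none]) x none := by
  induction h using Relation.ReflTransGen.head_induction_on generalizing ph x with
  | refl =>
    -- Without the extra bottom symbol, a run accepting with an empty stack would leave no symbol
    -- for `enter` to pop.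
    obtain ⟨z, s, hs⟩ : ∃ z s, d.stack.map some ++ [none] = z :: s :=
      List.exists_cons_of_ne_nil (by simp)
    rw [hs]
    exact M.pops_sim_acc hd hx z s
  | head hstep _ ih =>
    cases hstep with
    | @scan q p s i z w st v o hq ht =>
      simp only [List.map_append, List.append_assoc] at ih
      generalize hi : s :: i = i' at hx
      cases hx with
      | start =>
        obtain ⟨rfl, rfl⟩ := List.cons.inj hi
        exact .step (Sim.left hq ht) (ih (.middle x))
      | middle =>
        cases x with
        | nil =>
          obtain ⟨rfl, rfl⟩ := List.cons.inj hi
          exact .step (Sim.right hq ht) (ih .finish)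
        | cons a x =>
          obtain ⟨rfl, rfl⟩ := List.cons.inj hi
          exact .step (Sim.letter hq ht) (ih (.middle x))
      | finish => simp at hi
    | @lambda q p i z w st v o hq ht =>
      simp only [List.map_append, List.append_assoc] at ih
      exact .step (Sim.lambda hq ht) (ih hx)

/-- The state `none` is entered only from an accepting state of `M`, and up to the first `read` or
`enter` the simulation follows a genuine computation. The output is arbitrary since `Sim` ignores
it. -/
theorem accepting_of_pops_sim {s : Option (M.State × HeadPhase)} {t : List (Option M.Stack)}
    {x : List α} {r : Option (M.State × HeadPhase)} (h : Pops M.Sim s t x r) (hr : r = none)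
    {q : M.State} {ph : HeadPhase} (hs : s = some (q, ph)) {st : List M.Stack}
    (ht : t = st.map some ++ [none]) {i : List (TapeSymbol α)} (hx : IsRemaining ph x i)
    (o : List γ) :
    ∃ c, Relation.ReflTransGen M.Step ⟨q, i, st, o⟩ c ∧ c.state ∈ M.acc := by
  induction h generalizing q ph st i o with
  | nil => simp [hr] at hs
  | step hδ _ ih =>
    have split {z : M.Stack} {s : List (Option M.Stack)}
        (h : some z :: s = st.map some ++ [none]) : ∃ st', st = z :: st' ∧
          s = st'.map some ++ [none] := by
      cases st with
      | nil => simp at h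
      | cons y st' =>
        obtain ⟨h1, h2⟩ := List.cons.inj h
        exact ⟨st', by rw [Option.some.inj h1], h2⟩
    have happ (w st : List M.Stack) :
        w.map some ++ (st.map some ++ [none]) = (w ++ st).map some ++ [none] := by simp
    cases hδ with
    | left hq htr =>
      obtain ⟨st, rfl, rfl⟩ := split ht
      cases hs
      cases hx
      obtain ⟨c, hc, hacc⟩ := ih hr rfl (happ _ _) (.middle _) _
      exact ⟨c, .head (.scan hq htr) hc, hacc⟩
    | letter hq htr =>
      obtain ⟨st, rfl, rfl⟩ := split ht
      cases hs
      cases hx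
      obtain ⟨c, hc, hacc⟩ := ih hr rfl (happ _ _) (.middle _) _
      exact ⟨c, .head (.scan hq htr) hc, hacc⟩
    | right hq htr =>
      obtain ⟨st, rfl, rfl⟩ := split ht
      cases hs
      rename_i hpops
      obtain rfl := M.eq_nil_of_pops_sim hpops fun q ph h => by cases h; rfl
      cases hx
      obtain ⟨c, hc, hacc⟩ := ih hr rfl (happ _ _) .finish _
      exact ⟨c, .head (.scan hq htr) hc, hacc⟩
    | lambda hq htr =>
      obtain ⟨st, rfl, rfl⟩ := split ht
      cases hs
      obtain ⟨c, hc, hacc⟩ := ih hr rfl (happ _ _) hx _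
      exact ⟨c, .head (.lambda hq htr) hc, hacc⟩
    | enter ph z hq =>
      cases hs
      exact ⟨_, .refl, hq⟩
    | read a z hq =>
      cases hs
      exact ⟨_, .refl, hq⟩
    | pop => cases hs

/-- The domain of the multi-valued function computed by an npda is context-free. -/
theorem isContextFree_domain [Finite α] :
    Language.IsContextFree ({x | (M.outcomes x).Nonempty} : Language α) := by
  have := M.finite_state
  have := M.finite_stack
  obtain ⟨B, hB⟩ := M.exists_push_bound
  suffices h : {x | (M.outcomes x).Nonempty} =
      {x | Pops M.Sim (some (M.start, .start)) ([M.bottom].map some ++ [none]) x none} by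
    rw [h]
    exact isContextFree_pops M.Sim hB _ _ _
  ext x
  constructor
  · rintro ⟨_, c, hc, hacc, _⟩
    exact M.pops_sim_of_accepting hc hacc (.start x)
  · intro h
    obtain ⟨c, hc, hacc⟩ := M.accepting_of_pops_sim h rfl rfl rfl (.start x) []
    exact ⟨_, c, hc, hacc, rfl⟩

end NPDA

/-! ### Context-free languages on the second level -/

section Complement

variable (α : Type)

/-- The inner states of `complementMachine`. -/
inductive ComplementState : Type
  | copy
  | query
  | yes
  | no
  | acc
  | rej

instance : Finite ComplementState :=
  Finite.of_injective (fun s : ComplementState => match s with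
    | .copy => (0 : Fin 6)
    | .query => 1
    | .yes => 2
    | .no => 3
    | .acc => 4
    | .rej => 5) (by rintro (_ | _ | _ | _ | _ | _) (_ | _ | _ | _ | _ | _) h <;> simp_all)

/-- The oracle npda which copies its input to the query tape and accepts if the oracle answers
`no`. -/
def complementMachine : OracleNPDA α α Empty where
  State := ComplementState
  Stack := Unit
  finite_state := inferInstance
  finite_stack := inferInstance
  start := .copy
  bottom := ()
  acc := {.acc}
  rej := {.rej}
  acc_disjoint_rej := by simp
  query := .query
  yes := .yes
  no := .no
  query_ne_yes := by simp
  query_ne_no := by simp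
  yes_ne_no := by simp
  query_not_halting := by simp
  yes_not_halting := by simp
  no_not_halting := by simp
  trans q s z := match q, s with
    | .copy, some .left => {(.copy, [z], none, none)}
    | .copy, some (.letter a) => {(.copy, [z], some a, none)}
    | .copy, some .right => {(.query, [z], none, none)}
    | .yes, none => {(.rej, [z], none, none)}
    | .no, none => {(.acc, [z], none, none)}
    | _, _ => ∅
  finite_trans q s z := by
    rcases q with _ | _ | _ | _ | _ | _ <;> rcases s with _ | _ | _ | _ <;> simp

variable {α}

/-- The configurations which `complementMachine` can reach on the input `x` with the oracle `A`. -/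
inductive ComplementReach (A : Language α) (x : List α) : (complementMachine α).Config → Prop
  | start : ComplementReach A x ⟨.copy, inputTape x, [()], [], []⟩
  | copy (u v : List α) : u ++ v = x →
      ComplementReach A x ⟨.copy, v.map .letter ++ [.right], [()], u, []⟩
  | query : ComplementReach A x ⟨.query, [], [()], x, []⟩
  | yes : x ∈ A → ComplementReach A x ⟨.yes, [], [()], [], []⟩
  | no : x ∉ A → ComplementReach A x ⟨.no, [], [()], [], []⟩
  | acc : x ∉ A → ComplementReach A x ⟨.acc, [], [()], [], []⟩
  | rej : x ∈ A → ComplementReach A x ⟨.rej, [], [()], [], []⟩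

/-- An upper bound for the number of steps which `complementMachine` makes from a configuration. -/
def complementPotential (c : (complementMachine α).Config) : ℕ :=
  c.input.length + match (c.state : ComplementState) with
    | .copy => 2
    | .query => 2
    | .yes => 1
    | .no => 1
    | .acc => 0
    | .rej => 0

/-- A scan shortens the input; the answer and the move after it lower the state's contribution. -/
theorem ComplementReach.step {A : Language α} {x : List α} {c d : (complementMachine α).Config}
    (hc : ComplementReach A x c) (h : (complementMachine α).Step A c d) :
    ComplementReach A x d ∧ complementPotential d < complementPotential c := by
  cases hc with
  | start =>
    generalize hi : inputTape x = i at h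
    cases h with
    | scan _ _ ht =>
      obtain ⟨rfl, rfl⟩ := List.cons.inj hi
      cases ht
      exact ⟨.copy [] x rfl, by simp [complementPotential]⟩
    | lambda _ _ ht => cases ht
  | copy u v huv =>
    generalize hi : v.map TapeSymbol.letter ++ [.right] = i at h
    cases h with
    | scan _ _ ht =>
      cases v with
      | nil =>
        obtain ⟨rfl, rfl⟩ := List.cons.inj hi
        cases ht
        obtain rfl : u = x := by simpa using huv
        rw [Option.toList_none, List.append_nil]
        exact ⟨.query, by simp [complementPotential]⟩
      | cons a v =>
        obtain ⟨rfl, rfl⟩ := List.cons.inj hi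
        cases ht
        exact ⟨.copy (u ++ [a]) v (by simpa using huv), by simp [complementPotential]⟩
    | lambda _ _ ht => cases ht
  | query =>
    cases h with
    | lambda _ hq _ => exact absurd rfl hq
    | answerYes h => exact ⟨.yes h, by simp [complementPotential, complementMachine]⟩
    | answerNo h => exact ⟨.no h, by simp [complementPotential, complementMachine]⟩
  | yes hx =>
    cases h with
    | lambda _ _ ht =>
      cases ht
      exact ⟨.rej hx, by simp [complementPotential]⟩
  | no hx =>
    cases h with
    | lambda _ _ ht =>
      cases ht
      exact ⟨.acc hx, by simp [complementPotential]⟩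
  | acc =>
    cases h with
    | lambda _ _ ht => cases ht
  | rej =>
    cases h with
    | lambda _ _ ht => cases ht

theorem ComplementReach.exists_step {A : Language α} {x : List α}
    {c : (complementMachine α).Config} (hc : ComplementReach A x c) :
    c.state ∈ (complementMachine α).halt ∨ ∃ d, (complementMachine α).Step A c d := by
  have scan {s : TapeSymbol α} {p w u v}
      (h : (p, w, u, v) ∈ (complementMachine α).trans .copy (some s) ()) (i t o) :
      ∃ d, (complementMachine α).Step A ⟨.copy, s :: i, [()], t, o⟩ d :=
    ⟨_, .scan (by rintro (h | h) <;> cases h) nofun h⟩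
  cases hc with
  | start => exact .inr (scan (s := .left) rfl _ _ _)
  | copy u v =>
    cases v with
    | nil => exact .inr (scan (s := .right) rfl _ _ _)
    | cons a v => exact .inr (scan (s := .letter a) rfl _ _ _)
  | query =>
    by_cases h : x ∈ A
    · exact .inr ⟨_, .answerYes h⟩
    · exact .inr ⟨_, .answerNo h⟩
  | yes =>
    exact .inr ⟨_, .lambda (p := ComplementState.rej) (w := [()]) (u := none) (v := none)
      (by rintro (h | h) <;> cases h) nofun rfl⟩
  | no =>
    exact .inr ⟨_, .lambda (p := ComplementState.acc) (w := [()]) (u := none) (v := none)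
      (by rintro (h | h) <;> cases h) nofun rfl⟩
  | acc => exact .inl (.inl rfl)
  | rej => exact .inl (.inr rfl)

theorem ComplementReach.of_reflTransGen {A : Language α} {x : List α}
    {c d : (complementMachine α).Config} (hc : ComplementReach A x c)
    (h : Relation.ReflTransGen ((complementMachine α).Step A) c d) : ComplementReach A x d := by
  induction h with
  | refl => exact hc
  | tail _ h ih => exact (ih.step h).1

theorem complementMachine_terminates : (complementMachine α).Terminates := by
  -- The initial potential is `x.length + 4`: two endmarkers and 2 for the state `copy`.
  refine ⟨1, 4, fun A x => ⟨fun m path h0 hpath => ?_, fun d hd hstuck => ?_⟩⟩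
  · have hi : ∀ i ≤ m, ComplementReach A x (path i) ∧
        complementPotential (path i) + i ≤ 1 * x.length + 4 := by
      intro i
      induction i with
      | zero =>
        intro _
        rw [h0]
        exact ⟨.start, by simp [complementPotential, OracleNPDA.init, complementMachine, inputTape]⟩
      | succ i ih =>
        intro hi
        obtain ⟨h1, h2⟩ := ih (by omega)
        obtain ⟨h3, h4⟩ := h1.step (hpath i hi)
        exact ⟨h3, by omega⟩
    have := (hi m le_rfl).2
    omega
  · have hr : ComplementReach A x d := ComplementReach.of_reflTransGen .start hd
    exact hr.exists_step.resolve_right fun ⟨d', h⟩ => hstuck d' h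

theorem ComplementReach.exists_halting {A : Language α} {x : List α}
    {c : (complementMachine α).Config} (hc : ComplementReach A x c) :
    ∃ d, Relation.ReflTransGen ((complementMachine α).Step A) c d ∧
      d.state ∈ (complementMachine α).halt := by
  induction hn : complementPotential c using Nat.strong_induction_on generalizing c with
  | _ n ih =>
    obtain h | ⟨d, h⟩ := hc.exists_step
    · exact ⟨c, .refl, h⟩
    · obtain ⟨hd, hlt⟩ := hc.step h
      obtain ⟨e, he, hacc⟩ := ih _ (hn ▸ hlt) hd rfl
      exact ⟨e, .head h he, hacc⟩

theorem complementMachine_accepts (A : Language α) : (complementMachine α).accepts A = Aᶜ := by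
  ext x
  constructor
  · rintro ⟨c, hc, hacc⟩
    have hr : ComplementReach A x c := ComplementReach.of_reflTransGen .start hc
    cases hr with
    | acc h => exact h
    | _ => cases hacc
  · intro hx
    obtain ⟨d, hd, hhalt⟩ := (ComplementReach.start (A := A) (x := x)).exists_halting
    have hr : ComplementReach A x d := ComplementReach.of_reflTransGen .start hd
    refine ⟨d, hd, ?_⟩
    cases hr with
    | acc => rfl
    | rej h => exact absurd h hx
    | _ => rcases hhalt with h | h <;> cases h

/-- Every language of a family is recognized by oracle npda's with an oracle from the family of
complements. -/
theorem subset_CFLTuringFamily_co (C : LanguageFamily) (α : Type) [Finite α] :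
    C α ⊆ CFLTuringFamily (co C) α := fun L hL =>
  ⟨α, inferInstance, Lᶜ, by simpa [co] using hL, complementMachine α,
    complementMachine_terminates, by rw [complementMachine_accepts, compl_compl]⟩

end Complement

/-! ### Languages as single-valued functions -/

/-- The function with the only value `[]` on the words of `L` which is undefined elsewhere. -/
def indicator {α : Type} (L : Language α) : List α → Set (List Empty) :=
  fun x => {_y | x ∈ L}

theorem singleValued_of_empty {α : Type} (f : List α → Set (List Empty)) : SingleValued f :=
  fun _ => Set.subsingleton_of_subsingleton

/-- The empty alphabet has only one word, so an accepting path determines its output. -/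
theorem indicator_accepts {α β : Type} (M : OracleNPDA α β Empty) (A : Language β)
    (x : List α) : indicator (M.accepts A) x = M.outcomes A x := by
  ext y
  exact ⟨fun ⟨c, hc, hacc⟩ => ⟨c, hc, hacc, Subsingleton.elim _ _⟩,
    fun ⟨c, hc, hacc, _⟩ => ⟨c, hc, hacc⟩⟩

theorem indicator_injective {α : Type} : Function.Injective (indicator (α := α)) :=
  fun _ _ h => Set.ext fun x => Set.ext_iff.1 (congrFun h x) []

theorem indicator_mem_CFLSVTuringFamily_iff (C : LanguageFamily) {α : Type} [Finite α]
    {L : Language α} : indicator L ∈ CFLSVTuringFamily C α Empty ↔ L ∈ CFLTuringFamily C α := by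
  constructor
  · rintro ⟨β, hβ, A, hA, ⟨M, hM, hf⟩, _⟩
    exact ⟨β, hβ, A, hA, M, hM,
      indicator_injective (funext fun x => (indicator_accepts M A x).trans (hf x).symm)⟩
  · rintro ⟨β, hβ, A, hA, M, hM, rfl⟩
    exact ⟨β, hβ, A, hA, ⟨M, hM, indicator_accepts M A⟩, singleValued_of_empty _⟩

theorem mem_CFL_of_indicator_mem_CFLSV {α : Type} [Finite α] {L : Language α}
    (h : indicator L ∈ CFLSV α Empty) : L ∈ CFL α := by
  obtain ⟨⟨M, _, hf⟩, _⟩ := h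
  have hL : L = {x | (M.outcomes x).Nonempty} := by
    ext x
    change x ∈ L ↔ (M.outcomes x).Nonempty
    rw [← hf x]
    exact ⟨fun hx => ⟨[], hx⟩, fun ⟨_, hx⟩ => hx⟩
  rw [hL]
  exact M.isContextFree_domain

/-! ### The two implications -/

theorem SigmaCFL_eq_of_SigmaCFLSV_eq {k : ℕ} (hk : 1 ≤ k)
    (h : SigmaCFLSV k = SigmaCFLSV (k + 1)) : SigmaCFL k = SigmaCFL (k + 1) := by
  have hα (α : Type) [Finite α] : SigmaCFLSV k α Empty = SigmaCFLSV (k + 1) α Empty := by rw [h]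
  match k, hk with
  -- Level 1 is not given by oracle machines, so the inclusion of level 2 in `CFL` goes through the
  -- domain of an npda function.
  | 1, _ =>
    funext α _
    refine Set.Subset.antisymm (subset_CFLTuringFamily_co CFL α) fun L hL => ?_
    refine mem_CFL_of_indicator_mem_CFLSV ?_
    change indicator L ∈ SigmaCFLSV 1 α Empty
    rw [hα]
    exact (indicator_mem_CFLSVTuringFamily_iff _).2 hL
  | k + 2, _ =>
    funext α _
    ext L
    have h1 := indicator_mem_CFLSVTuringFamily_iff (PiCFL (k + 1)) (L := L)
    have h2 := indicator_mem_CFLSVTuringFamily_iff (PiCFL (k + 2)) (L := L)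
    exact h1.symm.trans ((Set.ext_iff.1 (hα α) _).trans h2)

theorem SigmaCFL_eq_add {k : ℕ} (hk : 1 ≤ k) (h : SigmaCFL k = SigmaCFL (k + 1)) (j : ℕ) :
    SigmaCFL k = SigmaCFL (k + j) := by
  obtain ⟨k, rfl⟩ := Nat.exists_eq_add_of_le' hk
  induction j with
  | zero => rfl
  | succ j ih =>
    refine h.trans ?_
    change CFLTuringFamily (co (SigmaCFL (k + 1))) = SigmaCFL (k + 1 + j + 1)
    rw [ih, show k + 1 + j = k + j + 1 by omega]
    rfl

theorem SigmaCFLSV_eq_of_SigmaCFL_eq {k : ℕ} (hk : 1 ≤ k) (h : SigmaCFL k = SigmaCFL (k + 1))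
    (j : ℕ) : SigmaCFLSV (k + 1) = SigmaCFLSV (k + j + 1) := by
  have hj := SigmaCFL_eq_add hk h j
  obtain ⟨k, rfl⟩ := Nat.exists_eq_add_of_le' hk
  change CFLSVTuringFamily (co (SigmaCFL (k + 1))) = _
  rw [hj, show k + 1 + j = k + j + 1 by omega]
  rfl

end CFLHierarchy

theorem mainTheorem12 (e k : ℕ) (he : 2 ≤ e) (hk : 1 ≤ k) :
    (CFLHierarchy.SigmaCFLSV k = CFLHierarchy.SigmaCFLSV (k + 1) →
      CFLHierarchy.SigmaCFL k = CFLHierarchy.SigmaCFL (k + 1)) ∧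
    (CFLHierarchy.SigmaCFL k = CFLHierarchy.SigmaCFL (k + 1) →
      CFLHierarchy.SigmaCFLSV (k + 1) = CFLHierarchy.SigmaCFLSV (k + e)) := by
  refine ⟨CFLHierarchy.SigmaCFL_eq_of_SigmaCFLSV_eq hk, fun h => ?_⟩
  -- Here `j = e - 1`, because the SV-level `k + e` takes its oracles from level `k + e - 1`.
  obtain ⟨j, rfl⟩ := Nat.exists_eq_add_of_le' (one_le_two.trans he)
  exact CFLHierarchy.SigmaCFLSV_eq_of_SigmaCFL_eq hk h j
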